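/- Let $\mathrm{Dr}(3,n)\subseteq\mathbb{R}^{\binom{[n]}{3}}$ be the Dressian, i.e. the set of all $\lambda$ such that for all pairwise distinct $s,i,j,k,l\in[n]$ the minimum of $\lambda_{sij}+\lambda_{skl}$, $\lambda_{sik}+\lambda_{sjl}$, $\lambda_{sil}+\lambda_{sjk}$ is attained at least twice. It carries the Plücker fan structure, in which two vectors lie in the same relatively open cone if and only if, for every such $s,i,j,k,l$, the same of these three terms attain the minimum. A vector $\lambda\in\mathrm{Dr}(3,n)$ spans a ray if its cone is one-dimensional modulo the lineality space $\{(\sum_{i\in X}u_i)_X : u\in\mathbb{R}^n\}$, i.e. if $\lambda$ does not lie in the lineality space and its cone consists of the vectors $c\lambda+\ell$ with $c>0$ and $\ell$ in the lineality space. The spread of $\lambda$ is the number of maximal cells of the regular subdivision of the hypersimplex $\Delta(3,n)=\mathrm{conv}\{e_X : X\in\binom{[n]}{3}\}$ induced by the weights $\lambda$. A regular subdivision of $\Delta(3,n)$ is a matroid subdivision if all of its cells are matroid polytopes, and a matroid subdivision is called coarsest if it is nontrivial and has no coarsening among the nontrivial regular matroid subdivisions other than itself. **Proposition 3.7 (unbounded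 spread).** As $n$ grows, the spread of the rays of $\mathrm{Dr}(3,n)$, i.e. the number of maximal cells of coarsest matroid subdivisions of $\Delta(3,n)$, is not bounded by a constant: for every $C\in\mathbb{N}$ there are an $n$ and a vector $\lambda$ spanning a ray of $\mathrm{Dr}(3,n)$ such that the regular subdivision of $\Delta(3,n)$ induced by $\lambda$ is a coarsest matroid subdivision with more than $C$ maximal cells. -/

import Mathlib

noncomputable section

/-- The set of `d`-element subsets of `[n]`; it indexes the Plücker coordinates `p_X`. -/
abbrev DSubset (d n : ℕ) : Type := {X : Finset (Fin n) // X.card = d}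

/-- A weight vector `λ ∈ ℝ^(n choose d)`. -/
abbrev Weight (d n : ℕ) : Type := DSubset d n → ℝ

/-! ### The Dressian and its Plücker fan structure -/

/-- The `d`-subset `S ∪ {a, b}`. -/
def DSubset.addPair {d n : ℕ} (S : Finset (Fin n)) (a b : Fin n) (hS : S.card + 2 = d)
    (ha : a ∉ S) (hb : b ∉ S) (hab : a ≠ b) : DSubset d n :=
  ⟨insert a (insert b S), by
    rw [Finset.card_insert_of_notMem (by simp [ha, hab]), Finset.card_insert_of_notMem hb]
    omega⟩

/-- The data of a three term Plücker relation
`p_{Sij} p_{Skl} - p_{Sik} p_{Sjl} + p_{Sil} p_{Sjk}`: a `(d-2)`-subset `S` of `[n]` and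
pairwise distinct `i, j, k, l ∈ [n] \ S`. -/
structure ThreeTerm (d n : ℕ) where
  S : Finset (Fin n)
  i : Fin n
  j : Fin n
  k : Fin n
  l : Fin n
  card_S : S.card + 2 = d
  hi : i ∉ S
  hj : j ∉ S
  hk : k ∉ S
  hl : l ∉ S
  hij : i ≠ j
  hik : i ≠ k
  hil : i ≠ l
  hjk : j ≠ k
  hjl : j ≠ l
  hkl : k ≠ l

/-- The weights, with respect to `w`, of the three monomials of a three term relation. -/
def ThreeTerm.weights {d n : ℕ} (τ : ThreeTerm d n) (w : Weight d n) : Fin 3 → ℝ :=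
  ![w (.addPair τ.S τ.i τ.j τ.card_S τ.hi τ.hj τ.hij)
      + w (.addPair τ.S τ.k τ.l τ.card_S τ.hk τ.hl τ.hkl),
    w (.addPair τ.S τ.i τ.k τ.card_S τ.hi τ.hk τ.hik)
      + w (.addPair τ.S τ.j τ.l τ.card_S τ.hj τ.hl τ.hjl),
    w (.addPair τ.S τ.i τ.l τ.card_S τ.hi τ.hl τ.hil)
      + w (.addPair τ.S τ.j τ.k τ.card_S τ.hj τ.hk τ.hjk)]

/-- The terms of lowest weight, i.e. the support of the initial form of the trinomial with
respect to `w`. The three monomials are distinct and their coefficients are fixed, so that the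
support determines the initial form. -/
def ThreeTerm.initialTerms {d n : ℕ} (τ : ThreeTerm d n) (w : Weight d n) : Set (Fin 3) :=
  {m | ∀ m', τ.weights w m ≤ τ.weights w m'}

/-- The Dressian `Dr(d,n)`, as a subset of `ℝ^(n choose d)`: the tropical prevariety of all three
term Plücker relations, where the minimum has to be attained at least twice in each relation. -/
def Dressian (d n : ℕ) : Set (Weight d n) :=
  {w | ∀ τ : ThreeTerm d n, ∃ m ∈ τ.initialTerms w, ∃ m' ∈ τ.initialTerms w, m ≠ m'}

/-- The relatively open cone of the Plücker fan structure that contains `w`: all vectors which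
specify the same initial form as `w` for each three term relation. -/
def pluckerCone {d n : ℕ} (w : Weight d n) : Set (Weight d n) :=
  {w' | ∀ τ : ThreeTerm d n, τ.initialTerms w' = τ.initialTerms w}

/-- The linear map `ℝ^n → ℝ^(n choose d)`, `u ↦ (∑ i ∈ X, u i)_X`. -/
def linealityMap (d n : ℕ) : (Fin n → ℝ) →ₗ[ℝ] Weight d n where
  toFun u := fun X => ∑ i ∈ X.1, u i
  map_add' u v := by ext X; simp [Finset.sum_add_distrib]
  map_smul' c u := by ext X; simp [Finset.mul_sum]

/-- The lineality space of the Dressian. -/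
def lineality (d n : ℕ) : Submodule ℝ (Weight d n) := LinearMap.range (linealityMap d n)

/-- `w` spans a ray of the fan `Dr(d,n)`: it lies in the Dressian and, modulo the lineality space,
its relatively open Plücker cone is the open half-line spanned by the nonzero class of `w`. -/
def SpansRay {d n : ℕ} (w : Weight d n) : Prop :=
  w ∈ Dressian d n ∧ w ∉ lineality d n ∧
    pluckerCone w = {w' | ∃ c : ℝ, 0 < c ∧ w' - c • w ∈ lineality d n}

/-! ### Regular subdivisions of the hypersimplex -/

/-- The vector `e_X = ∑ i ∈ X, e_i` of `ℝ^n`. -/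
def vertexVec {d n : ℕ} (X : DSubset d n) : Fin n → ℝ := fun i => if i ∈ X.1 then 1 else 0

/-- The polytope `conv {e_X | X ∈ 𝒳}` for a set `𝒳` of `d`-subsets of `[n]`. -/
def subsetPolytope {d n : ℕ} (𝒳 : Set (DSubset d n)) : Set (Fin n → ℝ) :=
  convexHull ℝ (vertexVec '' 𝒳)

/-- The hypersimplex `Δ(d,n)`. -/
def hypersimplex (d n : ℕ) : Set (Fin n → ℝ) := subsetPolytope (Set.univ : Set (DSubset d n))

/-- The `d`-subsets `X` whose lifted vertices `(e_X, w X)` lie on the lower face of the lifted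
polytope `conv {(e_X, w X)}` that is selected by the functional `(x, t) ↦ t - ∑ i, u i * x i`. -/
def lowerFace {d n : ℕ} (w : Weight d n) (u : Fin n → ℝ) : Set (DSubset d n) :=
  {X | ∀ Y : DSubset d n,
    w X - ∑ i, u i * vertexVec X i ≤ w Y - ∑ i, u i * vertexVec Y i}

/-- The (nonempty) cells of the regular subdivision of `Δ(d,n)` induced by `w`: the projections of
the lower faces of the lifted polytope. -/
def cells {d n : ℕ} (w : Weight d n) : Set (Set (Fin n → ℝ)) :=
  {P | ∃ u : Fin n → ℝ, P = subsetPolytope (lowerFace w u)}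

/-- The spread of `w`: the number of maximal cells of the regular subdivision induced by `w`. -/
def spread {d n : ℕ} (w : Weight d n) : ℕ := {P | Maximal (· ∈ cells w) P}.ncard

/-- `P` is the matroid polytope of a matroid of rank `d` on `[n]`. -/
def IsMatroidPolytope (d : ℕ) {n : ℕ} (P : Set (Fin n → ℝ)) : Prop :=
  ∃ (M : Matroid (Fin n)) (ℬ : Set (DSubset d n)),
    (∀ B : Finset (Fin n), M.IsBase (B : Set (Fin n)) ↔ ∃ X ∈ ℬ, X.1 = B) ∧
      P = subsetPolytope ℬ

/-- The regular subdivision induced by `w` is a matroid subdivision. -/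
def InducesMatroidSubdivision {d n : ℕ} (w : Weight d n) : Prop :=
  ∀ P ∈ cells w, IsMatroidPolytope d P

/-- The regular subdivision induced by `w` is trivial: `Δ(d,n)` itself is a cell. -/
def InducesTrivialSubdivision {d n : ℕ} (w : Weight d n) : Prop :=
  hypersimplex d n ∈ cells w

/-- The subdivision induced by `w'` is a coarsening of the one induced by `w`. -/
def Coarsens {d n : ℕ} (w' w : Weight d n) : Prop :=
  ∀ P ∈ cells w, ∃ Q ∈ cells w', P ⊆ Q

/-- The regular subdivision induced by `w` is a coarsest (nontrivial regular) matroid subdivision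
of `Δ(d,n)`. -/
def InducesCoarsestMatroidSubdivision {d n : ℕ} (w : Weight d n) : Prop :=
  InducesMatroidSubdivision w ∧ ¬ InducesTrivialSubdivision w ∧
    ∀ w' : Weight d n, InducesMatroidSubdivision w' → ¬ InducesTrivialSubdivision w' →
      Coarsens w' w → cells w' = cells w

end

/-! The witness is the vector of tropical maximal minors of the 3 × n matrix with columns (0, ⌊x/2⌋,
⌈x/2⌉), x = 0, …, n-1, a staircase of lattice points. The tropical 2 × 2 minors `stripPair` are
monotone in both arguments, so the weight of a triple depends only on its two smallest elements
(`coord_stripWeight`) and every three term relation becomes integer arithmetic with halves and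
parities.

Ray: vectors in the Plücker cone of w satisfy the linear equations saying that the terms lowest for
w stay equal (`IsBalanced`). By `spansRay_of_isBalanced` it suffices that all solutions lie in ℝw
plus the lineality space. A multiple of w and a lineality vector normalise n + 1 coordinates of a
solution to zero, and a walk along the staircase then kills all the others
(`IsBalanced.strip_eq_zero`).

Coarsest: this holds for every ray. Points of the Dressian induce matroid subdivisions because the
three term relations yield basis exchange on each lower face (`exists_exchange`). A coarsening w' of
w can only enlarge the sets of lowest terms (`Coarsens.initialTerms_subset`), so w + Mw' stays in
the cone of w for all M ≥ 0; since that cone is a ray, w' is a nonnegative multiple of w modulo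
lineality.

Spread: the triples {0, 2i+2, 2i+3} pairwise share no cell (`le_spread_stripWeight`), hence lie in
distinct maximal cells, and their number grows with n. -/

/-! ### Access to the coordinates of a weight vector in rank three -/

/-- The coordinate of `w` at `{a, b, c}`, or `0` if `a, b, c` are not pairwise distinct. -/
noncomputable def coord {n : ℕ} (w : Weight 3 n) (a b c : Fin n) : ℝ :=
  if h : ({a, b, c} : Finset (Fin n)).card = 3 then w ⟨{a, b, c}, h⟩ else 0

lemma coord_congr {n : ℕ} (w : Weight 3 n) {a b c a' b' c' : Fin n}
    (h : ({a, b, c} : Finset (Fin n)) = {a', b', c'}) : coord w a b c = coord w a' b' c' := by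
  unfold coord
  simp only [h]

lemma coord_comm₁₂ {n : ℕ} (w : Weight 3 n) (a b c : Fin n) : coord w a b c = coord w b a c :=
  coord_congr w (Finset.insert_comm _ _ _)

lemma coord_comm₂₃ {n : ℕ} (w : Weight 3 n) (a b c : Fin n) : coord w a b c = coord w a c b :=
  coord_congr w (by rw [Finset.pair_comm])

lemma coord_of_eq {n : ℕ} (w : Weight 3 n) (X : DSubset 3 n) {a b c : Fin n}
    (h : X.1 = {a, b, c}) : w X = coord w a b c := by
  have hc : ({a, b, c} : Finset (Fin n)).card = 3 := h ▸ X.2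
  rw [coord, dif_pos hc]
  exact congrArg w (Subtype.ext h)

lemma exists_triple {n : ℕ} {a b c : Fin n} (hab : a ≠ b) (hac : a ≠ c) (hbc : b ≠ c) :
    ∃ X : DSubset 3 n, X.1 = {a, b, c} :=
  ⟨⟨{a, b, c}, Finset.card_eq_three.2 ⟨a, b, c, hab, hac, hbc, rfl⟩⟩, rfl⟩

lemma coord_sub {n : ℕ} (v w : Weight 3 n) (a b c : Fin n) :
    coord (v - w) a b c = coord v a b c - coord w a b c := by
  unfold coord; split_ifs <;> simp

lemma coord_smul {n : ℕ} (r : ℝ) (w : Weight 3 n) (a b c : Fin n) :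
    coord (r • w) a b c = r * coord w a b c := by
  unfold coord; split_ifs <;> simp

lemma coord_linealityMap {n : ℕ} (u : Fin n → ℝ) {a b c : Fin n}
    (hab : a ≠ b) (hac : a ≠ c) (hbc : b ≠ c) :
    coord (linealityMap 3 n u) a b c = u a + u b + u c := by
  obtain ⟨X, hX⟩ := exists_triple hab hac hbc
  rw [← coord_of_eq _ X hX]
  simp [linealityMap, hX, Finset.sum_insert, hab, hac, hbc, add_assoc]

lemma sum_mul_vertexVec {d n : ℕ} (u : Fin n → ℝ) (X : DSubset d n) :
    ∑ i, u i * vertexVec X i = ∑ i ∈ X.1, u i := by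
  simp [vertexVec]

lemma ne_of_card_triple {n : ℕ} {a b c : Fin n} (h : ({a, b, c} : Finset (Fin n)).card = 3) :
    a ≠ b ∧ a ≠ c ∧ b ≠ c := by
  refine ⟨?_, ?_, ?_⟩ <;> rintro rfl
  · have := Finset.card_le_two (a := a) (b := c)
    simp at h; omega
  · have := Finset.card_le_two (a := a) (b := b)
    rw [Finset.pair_comm] at h; simp at h; omega
  · have := Finset.card_le_two (a := a) (b := b)
    simp at h; omega

lemma sum_triple {n : ℕ} (u : Fin n → ℝ) (X : DSubset 3 n) {a b c : Fin n}
    (h : X.1 = {a, b, c}) : ∑ i ∈ X.1, u i = u a + u b + u c := by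
  obtain ⟨hab, hac, hbc⟩ := ne_of_card_triple (h ▸ X.2)
  simp [h, Finset.sum_insert, hab, hac, hbc, add_assoc]

/-! ### Three term relations in rank three -/

/-- The weights of the terms of the three term relation on `s, i, j, k, l`. -/
noncomputable def plueckerTerms {n : ℕ} (w : Weight 3 n) (s i j k l : Fin n) : Fin 3 → ℝ :=
  ![coord w s i j + coord w s k l, coord w s i k + coord w s j l, coord w s i l + coord w s j k]

lemma addPair_singleton {n : ℕ} (w : Weight 3 n) {s a b : Fin n}
    (hS : ({s} : Finset (Fin n)).card + 2 = 3) (ha : a ∉ ({s} : Finset (Fin n)))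
    (hb : b ∉ ({s} : Finset (Fin n))) (hab : a ≠ b) :
    w (.addPair {s} a b hS ha hb hab) = coord w s a b := by
  rw [coord_comm₁₂, coord_comm₂₃]
  exact coord_of_eq w _ rfl

lemma ThreeTerm.exists_weights_eq {n : ℕ} (τ : ThreeTerm 3 n) :
    ∃ s i j k l : Fin n, [s, i, j, k, l].Nodup ∧
      ∀ w : Weight 3 n, τ.weights w = plueckerTerms w s i j k l := by
  obtain ⟨S, i, j, k, l, hS, hi, hj, hk, hl, hij, hik, hil, hjk, hjl, hkl⟩ := τ
  obtain ⟨s, rfl⟩ := Finset.card_eq_one.1 (by omega : S.card = 1)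
  refine ⟨s, i, j, k, l, ?_, fun w => ?_⟩
  · simp only [Finset.mem_singleton] at hi hj hk hl
    simp [*, Ne.symm hi, Ne.symm hj, Ne.symm hk, Ne.symm hl]
  · simp [ThreeTerm.weights, plueckerTerms, addPair_singleton]

lemma exists_threeTerm {n : ℕ} {s i j k l : Fin n} (h : [s, i, j, k, l].Nodup) :
    ∃ τ : ThreeTerm 3 n, ∀ w : Weight 3 n, τ.weights w = plueckerTerms w s i j k l := by
  simp only [List.nodup_cons, List.mem_cons, List.not_mem_nil, not_or, or_false] at h
  obtain ⟨⟨h1, h2, h3, h4⟩, ⟨h5, h6, h7⟩, ⟨h8, h9⟩, h10, -⟩ := h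
  refine ⟨⟨{s}, i, j, k, l, by simp, ?_, ?_, ?_, ?_, h5, h6, h7, h8, h9, h10⟩, fun w => ?_⟩
  iterate 4 simp only [Finset.mem_singleton]; exact Ne.symm ‹_›
  simp [ThreeTerm.weights, plueckerTerms, addPair_singleton]

/-- The minimum of three numbers is attained at least twice. -/
def MinTwice (x y z : ℝ) : Prop := (x = y ∧ x ≤ z) ∨ (x = z ∧ x ≤ y) ∨ (y = z ∧ y ≤ x)

lemma mem_initialTerms {d n : ℕ} (τ : ThreeTerm d n) (w : Weight d n) (m : Fin 3) :
    m ∈ τ.initialTerms w ↔ ∀ m', τ.weights w m ≤ τ.weights w m' := Iff.rfl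

lemma exists_two_min_iff (t : Fin 3 → ℝ) :
    (∃ m, (∀ m', t m ≤ t m') ∧ ∃ m', (∀ m'', t m' ≤ t m'') ∧ m ≠ m') ↔
      MinTwice (t 0) (t 1) (t 2) := by
  constructor
  · rintro ⟨m, hm, m', hm', hne⟩
    have h0 := hm 0
    have h1 := hm 1
    have h2 := hm 2
    have h0' := hm' 0
    have h1' := hm' 1
    have h2' := hm' 2
    unfold MinTwice
    fin_cases m <;> fin_cases m' <;> simp at * <;> grind
  · rintro (⟨h, h'⟩ | ⟨h, h'⟩ | ⟨h, h'⟩)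
    · exact ⟨0, by simp [Fin.forall_fin_succ]; grind, 1, by simp [Fin.forall_fin_succ]; grind,
        by decide⟩
    · exact ⟨0, by simp [Fin.forall_fin_succ]; grind, 2, by simp [Fin.forall_fin_succ]; grind,
        by decide⟩
    · exact ⟨1, by simp [Fin.forall_fin_succ]; grind, 2, by simp [Fin.forall_fin_succ]; grind,
        by decide⟩

lemma mem_dressian_three {n : ℕ} (w : Weight 3 n) :
    w ∈ Dressian 3 n ↔ ∀ s i j k l : Fin n, [s, i, j, k, l].Nodup →
      MinTwice (coord w s i j + coord w s k l) (coord w s i k + coord w s j l)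
        (coord w s i l + coord w s j k) := by
  constructor
  · intro h s i j k l hn
    obtain ⟨τ, hτ⟩ := exists_threeTerm hn
    have := (exists_two_min_iff (τ.weights w)).1 (h τ)
    simpa [hτ, plueckerTerms] using this
  · intro h τ
    obtain ⟨s, i, j, k, l, hn, hτ⟩ := τ.exists_weights_eq
    refine (exists_two_min_iff (τ.weights w)).2 ?_
    simpa [hτ, plueckerTerms] using h s i j k l hn

/-! ### Weights in the Dressian induce matroid subdivisions -/

lemma MinTwice.le_or_le {x y z : ℝ} (h : MinTwice x y z) : y ≤ x ∨ z ≤ x := by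
  unfold MinTwice at h; grind

lemma MinTwice.add_left {x y z : ℝ} (h : MinTwice x y z) (t : ℝ) :
    MinTwice (t + x) (t + y) (t + z) := by
  unfold MinTwice at *; simpa using h

lemma sub_linealityMap_mem_dressian {n : ℕ} {w : Weight 3 n} (hw : w ∈ Dressian 3 n)
    (u : Fin n → ℝ) : w - linealityMap 3 n u ∈ Dressian 3 n := by
  rw [mem_dressian_three] at hw ⊢
  intro s i j k l h
  have key := (hw s i j k l h).add_left (-(2 * u s + u i + u j + u k + u l))
  simp only [List.nodup_cons, List.mem_cons, List.not_mem_nil, not_or, or_false] at h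
  obtain ⟨⟨h1, h2, h3, h4⟩, ⟨h5, h6, h7⟩, ⟨h8, h9⟩, h10, -⟩ := h
  simp only [coord_sub, coord_linealityMap, ne_eq, not_false_eq_true, *]
  convert key using 1 <;> ring

/-- The weights of a rank three valuated matroid satisfy basis exchange at disjoint minimal
triples. -/
lemma exists_exchange_of_disjoint {n : ℕ} {w : Weight 3 n} (hw : w ∈ Dressian 3 n) {μ : ℝ}
    {a b c d e f : Fin n} (hn : [a, b, c, d, e, f].Nodup)
    (hmin : ∀ x y z : Fin n, [x, y, z].Nodup → μ ≤ coord w x y z)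
    (h₁ : coord w a b c = μ) (h₂ : coord w d e f = μ) :
    coord w d b c = μ ∨ coord w e b c = μ ∨ coord w f b c = μ := by
  rw [mem_dressian_three] at hw
  simp only [List.nodup_cons, List.mem_cons, List.not_mem_nil, not_or, or_false,
    List.nodup_nil, not_false_eq_true, and_true] at hn hw hmin
  by_contra! hcon
  have hd : μ < coord w d b c := lt_of_le_of_ne (hmin _ _ _ (by grind)) (Ne.symm hcon.1)
  have he : μ < coord w e b c := lt_of_le_of_ne (hmin _ _ _ (by grind)) (Ne.symm hcon.2.1)
  have hf : μ < coord w f b c := lt_of_le_of_ne (hmin _ _ _ (by grind)) (Ne.symm hcon.2.2)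
  -- Write xy for the weight of {c, x, y} with x, y among a, d, e, f. The relations at c compare
  -- these values, and those at d, e, f, with μ as global minimum, give: de or df is ≤ ad, de or ef
  -- is ≤ ae, df or ef is ≤ af.
  have R₁ := hw c b a d e (by grind)
  have R₂ := hw c b a d f (by grind)
  have R₃ := hw c b a e f (by grind)
  have Q₁ := (hw d c a e f (by grind)).le_or_le
  have Q₂ := (hw e c a d f (by grind)).le_or_le
  have Q₃ := (hw f c a d e (by grind)).le_or_le
  have m₁ := hmin d a f (by grind)
  have m₂ := hmin d a e (by grind)
  have m₃ := hmin e a f (by grind)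
  have cx : ∀ x, coord w c b x = coord w x b c := fun x => by
    rw [coord_comm₁₂, coord_comm₂₃, coord_comm₁₂]
  have cd : ∀ x y, coord w x c y = coord w c x y := fun x y => coord_comm₁₂ _ _ _ _
  have e₁ : coord w e d f = μ := by rw [coord_comm₁₂, h₂]
  have e₂ : coord w f d e = μ := by rw [coord_comm₁₂, coord_comm₂₃, h₂]
  have e₃ : coord w e a d = coord w d a e := by
    rw [coord_comm₁₂, coord_comm₂₃, coord_comm₁₂]
  have e₄ : coord w f a d = coord w d a f := by
    rw [coord_comm₁₂, coord_comm₂₃, coord_comm₁₂]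
  have e₅ : coord w f a e = coord w e a f := by
    rw [coord_comm₁₂, coord_comm₂₃, coord_comm₁₂]
  simp only [cx, cd, h₁, h₂, e₁, e₂, e₃, e₄, e₅] at R₁ R₂ R₃ Q₁ Q₂ Q₃
  rw [coord_comm₂₃ w c d a] at Q₁
  rw [coord_comm₂₃ w c e a, coord_comm₂₃ w c e d] at Q₂
  rw [coord_comm₂₃ w c f a, coord_comm₂₃ w c f d, coord_comm₂₃ w c f e] at Q₃
  unfold MinTwice at R₁ R₂ R₃
  generalize coord w d b c = D at *
  generalize coord w e b c = E at *
  generalize coord w f b c = F at *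
  generalize coord w c a d = ad at *
  generalize coord w c a e = ae at *
  generalize coord w c a f = af at *
  generalize coord w c d e = de at *
  generalize coord w c d f = df at *
  generalize coord w c e f = ef at *
  clear hw hmin hn cx cd
  -- If de ≤ ad, the strict bounds on D, E, F turn the relations into the cycle ad < df ≤ af < ef ≤
  -- ae < de ≤ ad. The alternative df ≤ ad gives the same cycle with e and f exchanged.
  rcases Q₁ with q₁ | q₁ <;> rcases Q₂ with q₂ | q₂ <;> rcases Q₃ with q₃ | q₃ <;>
    rcases R₁ with ⟨r₁, r₁'⟩ | ⟨r₁, r₁'⟩ | ⟨r₁, r₁'⟩ <;>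
    rcases R₂ with ⟨r₂, r₂'⟩ | ⟨r₂, r₂'⟩ | ⟨r₂, r₂'⟩ <;>
    rcases R₃ with ⟨r₃, r₃'⟩ | ⟨r₃, r₃'⟩ | ⟨r₃, r₃'⟩ <;> linarith

/-- In the relation at b on a, c, d, e the first term is 2μ, the least possible value. A second term
must also equal 2μ, which forces both of its summands to be μ. -/
lemma exists_exchange_of_common {n : ℕ} {w : Weight 3 n} (hw : w ∈ Dressian 3 n) {μ : ℝ}
    {a b c d e : Fin n} (hn : [a, b, c, d, e].Nodup)
    (hmin : ∀ x y z : Fin n, [x, y, z].Nodup → μ ≤ coord w x y z)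
    (h₁ : coord w a b c = μ) (h₂ : coord w b d e = μ) :
    coord w d b c = μ ∨ coord w e b c = μ := by
  rw [mem_dressian_three] at hw
  simp only [List.nodup_cons, List.mem_cons, List.not_mem_nil, not_or, or_false,
    List.nodup_nil, not_false_eq_true, and_true] at hn hw hmin
  have R := hw b a c d e (by grind)
  have m₁ := hmin b a d (by grind)
  have m₂ := hmin b a e (by grind)
  have m₃ := hmin b c e (by grind)
  have m₄ := hmin b c d (by grind)
  rw [coord_comm₁₂ w b a c, h₁, h₂] at R
  rw [coord_comm₁₂ w d, coord_comm₂₃ w b d, coord_comm₁₂ w e, coord_comm₂₃ w b e]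
  unfold MinTwice at R
  rcases R with ⟨r, r'⟩ | ⟨r, r'⟩ | ⟨r, r'⟩
  · right; linarith
  · left; linarith
  · right; linarith

/-- The cases follow how many of the two remaining elements of A lie in B: with both, B itself is
the exchanged basis; with one or none, the two previous lemmas apply. -/
lemma exists_exchange {n : ℕ} {w : Weight 3 n} (hw : w ∈ Dressian 3 n) {A B : DSubset 3 n}
    (hA : ∀ Y, w A ≤ w Y) (hB : ∀ Y, w B ≤ w Y) {a : Fin n} (ha : a ∈ A.1) (haB : a ∉ B.1) :
    ∃ x ∈ B.1, x ∉ A.1 ∧ ∃ X : DSubset 3 n, X.1 = insert x (A.1.erase a) ∧ ∀ Y, w X ≤ w Y := by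
  obtain ⟨b, c, hbc, hA'⟩ := Finset.card_eq_two.1
    (by rw [Finset.card_erase_of_mem ha, A.2] : (A.1.erase a).card = 2)
  have hab : a ≠ b := fun h => by
    have : b ∈ A.1.erase a := by simp [hA']
    simp [h] at this
  have hac : a ≠ c := fun h => by
    have : c ∈ A.1.erase a := by simp [hA']
    simp [h] at this
  have hA₁ : A.1 = {a, b, c} := by rw [← Finset.insert_erase ha, hA']
  have hmin : ∀ x y z : Fin n, [x, y, z].Nodup → w A ≤ coord w x y z := fun x y z h => by
    simp at h
    obtain ⟨X, hX⟩ := exists_triple h.1.1 h.1.2 h.2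
    exact coord_of_eq w X hX ▸ hA X
  have hAB : w A = w B := le_antisymm (hA _) (hB _)
  have h₁ : coord w a b c = w A := (coord_of_eq w A hA₁).symm
  have done : ∀ x ∈ B.1, x ∉ A.1 → coord w x b c = w A →
      ∃ x ∈ B.1, x ∉ A.1 ∧ ∃ X : DSubset 3 n, X.1 = insert x (A.1.erase a) ∧ ∀ Y, w X ≤ w Y := by
    intro x hxB hxA hx
    rw [hA₁] at hxA
    simp only [Finset.mem_insert, Finset.mem_singleton, not_or] at hxA
    obtain ⟨X, hX⟩ := exists_triple hxA.2.1 hxA.2.2 hbc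
    refine ⟨x, hxB, by simp [hA₁, hxA], X, by rw [hX, hA'], fun Y => ?_⟩
    rw [coord_of_eq w X hX, hx]
    exact hA Y
  have common : ∀ b c : Fin n, b ≠ c → a ≠ b → a ≠ c → A.1 = {a, b, c} → b ∈ B.1 → c ∉ B.1 →
      ∃ x ∈ B.1, x ∉ A.1 ∧ coord w x b c = w A := by
    intro b c hbc hab hac hA₁ hb hc
    obtain ⟨d, e, hde, hB'⟩ := Finset.card_eq_two.1
      (by rw [Finset.card_erase_of_mem hb, B.2] : (B.1.erase b).card = 2)
    have hB₁ : B.1 = {b, d, e} := by rw [← Finset.insert_erase hb, hB']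
    have hd : d ∈ B.1.erase b := by simp [hB']
    have he : e ∈ B.1.erase b := by simp [hB']
    have hd' := Finset.mem_of_mem_erase hd
    have he' := Finset.mem_of_mem_erase he
    have hd'' := Finset.ne_of_mem_erase hd
    have he'' := Finset.ne_of_mem_erase he
    have h₂ : coord w b d e = w A := by rw [hAB]; exact (coord_of_eq w B hB₁).symm
    have hn : [a, b, c, d, e].Nodup := by simp; grind
    have h3 : d ∉ A.1 := by rw [hA₁]; simp; grind
    have h4 : e ∉ A.1 := by rw [hA₁]; simp; grind
    rcases exists_exchange_of_common hw hn hmin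
      ((coord_of_eq w A hA₁).symm) h₂ with h | h
    · exact ⟨d, hd', h3, h⟩
    · exact ⟨e, he', h4, h⟩
  by_cases hb : b ∈ B.1 <;> by_cases hc : c ∈ B.1
  · obtain ⟨d, hd⟩ := Finset.card_eq_one.1
      (by rw [Finset.card_erase_of_mem (by simp [hc, hbc.symm]), Finset.card_erase_of_mem hb, B.2] :
        ((B.1.erase b).erase c).card = 1)
    have hd' : d ∈ (B.1.erase b).erase c := by simp [hd]
    simp only [Finset.mem_erase] at hd'
    refine done d hd'.2.2 (by rw [hA₁]; simp; grind) ?_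
    have hB₁ : B.1 = {d, b, c} := by
      rw [← Finset.insert_erase hb,
        ← Finset.insert_erase (by simp [hc, hbc.symm] : c ∈ B.1.erase b), hd]
      ext; simp; tauto
    rw [hAB, coord_of_eq w B hB₁]
  · obtain ⟨x, hx, hxA, h⟩ := common b c hbc hab hac hA₁ hb hc
    exact done x hx hxA h
  · obtain ⟨x, hx, hxA, h⟩ := common c b hbc.symm hac hab (by rw [hA₁, Finset.pair_comm]) hc hb
    exact done x hx hxA (by rw [coord_comm₂₃, h])
  · obtain ⟨d, e, f, hde, hdf, hef, hB₁⟩ := Finset.card_eq_three.1 B.2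
    have h₂ : coord w d e f = w A := by rw [hAB]; exact (coord_of_eq w B hB₁).symm
    have hn : [a, b, c, d, e, f].Nodup := by
      rw [hB₁] at haB hb hc
      simp at haB hb hc ⊢
      grind
    simp only [List.nodup_cons, List.mem_cons, List.not_mem_nil, not_or, or_false] at hn
    rcases exists_exchange_of_disjoint hw (by simp; grind) hmin h₁ h₂ with h | h | h
    · exact done d (by simp [hB₁]) (by rw [hA₁]; simp; grind) h
    · exact done e (by simp [hB₁]) (by rw [hA₁]; simp; grind) h
    · exact done f (by simp [hB₁]) (by rw [hA₁]; simp; grind) h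

lemma mem_lowerFace_iff {d n : ℕ} (w : Weight d n) (u : Fin n → ℝ) (X : DSubset d n) :
    X ∈ lowerFace w u ↔ ∀ Y, (w - linealityMap d n u) X ≤ (w - linealityMap d n u) Y := by
  simp only [lowerFace, sum_mul_vertexVec]
  rfl

lemma lowerFace_nonempty {d n : ℕ} [Nonempty (DSubset d n)] (w : Weight d n) (u : Fin n → ℝ) :
    (lowerFace w u).Nonempty := by
  obtain ⟨X, hX⟩ := Finite.exists_min (w - linealityMap d n u)
  exact ⟨X, (mem_lowerFace_iff w u X).2 hX⟩

/-- Weights in the Dressian induce matroid subdivisions. -/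
theorem inducesMatroidSubdivision_of_mem_dressian {n : ℕ} (hn : 3 ≤ n) {w : Weight 3 n}
    (hw : w ∈ Dressian 3 n) : InducesMatroidSubdivision w := by
  rintro P ⟨u, rfl⟩
  have : Nonempty (DSubset 3 n) := by
    obtain ⟨t, -, ht⟩ := Finset.exists_subset_card_eq (s := (Finset.univ : Finset (Fin n)))
      (n := 3) (by simpa using hn)
    exact ⟨⟨t, ht⟩⟩
  have hv := sub_linealityMap_mem_dressian hw u
  let isB : Set (Fin n) → Prop := fun B => ∃ X ∈ lowerFace w u, (X.1 : Set (Fin n)) = B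
  have hex : Matroid.ExchangeProperty isB := by
    rintro _ _ ⟨A, hA, rfl⟩ ⟨B, hB, rfl⟩ a ⟨haA, haB⟩
    rw [mem_lowerFace_iff] at hA hB
    obtain ⟨x, hxB, hxA, X, hX, hmin⟩ := exists_exchange hv hA hB (by simpa using haA)
      (by simpa using haB)
    refine ⟨x, ⟨by simpa using hxB, by simpa using hxA⟩, X, (mem_lowerFace_iff _ _ _).2 hmin, ?_⟩
    rw [hX]
    simp
  refine ⟨Matroid.ofIsBaseOfFinite (E := Set.univ) Set.finite_univ isB ?_ hex
    (fun _ _ => Set.subset_univ _), lowerFace w u, fun B => ?_, rfl⟩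
  · obtain ⟨X, hX⟩ := lowerFace_nonempty w u
    exact ⟨_, X, hX, rfl⟩
  · simp [isB]

/-! ### Cells of regular subdivisions -/

/-- The sum of the coordinates in X takes the value |X ∩ Y| at the vertex of Y, which is d only for
Y = X. Hence a cell determines its set of vertices, and inclusions of cells can be read off from
lower faces. -/
lemma mem_of_vertexVec_mem_subsetPolytope {d n : ℕ} {𝒳 : Set (DSubset d n)} {X : DSubset d n}
    (h : vertexVec X ∈ subsetPolytope 𝒳) : X ∈ 𝒳 := by
  by_contra hX
  let φ : (Fin n → ℝ) →ₗ[ℝ] ℝ := ∑ i ∈ X.1, LinearMap.proj i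
  have hφ : ∀ Y : DSubset d n, φ (vertexVec Y) = (X.1 ∩ Y.1).card := by
    intro Y
    simp [φ, vertexVec, Finset.sum_ite_mem]
  have hsub : subsetPolytope 𝒳 ⊆ {v | φ v ≤ d - 1} := by
    refine convexHull_min ?_ (convex_halfSpace_le φ.isLinear _)
    rintro _ ⟨Y, hY, rfl⟩
    have hlt : (X.1 ∩ Y.1).card < d := by
      refine lt_of_lt_of_eq ?_ X.2
      refine Finset.card_lt_card (Finset.inter_subset_left.ssubset_of_ne fun he => hX ?_)
      have : X.1 = Y.1 := Finset.eq_of_subset_of_card_le (Finset.inter_eq_left.1 he)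
        (by rw [X.2, Y.2])
      rwa [Subtype.ext this]
    rw [Set.mem_ofPred_eq, hφ, le_sub_iff_add_le]
    exact_mod_cast hlt
  have := hsub h
  rw [Set.mem_ofPred_eq, hφ, Finset.inter_self, X.2] at this
  linarith

lemma subset_of_subsetPolytope_subset {d n : ℕ} {𝒳 𝒴 : Set (DSubset d n)}
    (h : subsetPolytope 𝒳 ⊆ subsetPolytope 𝒴) : 𝒳 ⊆ 𝒴 := fun X hX =>
  mem_of_vertexVec_mem_subsetPolytope (h (subset_convexHull ℝ _ ⟨X, hX, rfl⟩))

lemma cells_finite {d n : ℕ} (w : Weight d n) : (cells w).Finite :=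
  (Set.finite_range (subsetPolytope (d := d) (n := n))).subset (by
    rintro _ ⟨u, rfl⟩
    exact ⟨_, rfl⟩)

lemma exists_mem_lowerFace {d n : ℕ} (w : Weight d n) (X : DSubset d n) :
    ∃ u, X ∈ lowerFace w u := by
  obtain ⟨K, hK⟩ := (Set.finite_range fun Y : DSubset d n => w X - w Y).bddAbove
  have hK' : ∀ Y, w X - w Y ≤ K := fun Y => hK ⟨Y, rfl⟩
  have hK0 : 0 ≤ K := by simpa using hK' X
  refine ⟨fun i => if i ∈ X.1 then K else 0, fun Y => ?_⟩
  simp only [sum_mul_vertexVec, Finset.sum_ite_mem, Finset.sum_const, nsmul_eq_mul,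
    Finset.inter_self]
  rcases eq_or_ne Y X with rfl | hne
  · simp
  have hlt : (Y.1 ∩ X.1).card < X.1.card := by
    refine Finset.card_lt_card (Finset.inter_subset_right.ssubset_of_ne fun he => hne ?_)
    exact (Subtype.ext (Finset.eq_of_subset_of_card_le (Finset.inter_eq_right.1 he)
        (by rw [X.2, Y.2]))).symm
  have : ((Y.1 ∩ X.1).card : ℝ) + 1 ≤ X.1.card := by exact_mod_cast hlt
  nlinarith [hK' Y]

/-- A family of vertices, no two of which lie in a common cell, bounds the spread from below. -/
lemma card_le_spread {d n : ℕ} (w : Weight d n) {ι : Type*} [Fintype ι] (A : ι → DSubset d n)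
    (hA : ∀ i j u, A i ∈ lowerFace w u → A j ∈ lowerFace w u → i = j) :
    Fintype.card ι ≤ spread w := by
  have hmax : ∀ i, ∃ P, Maximal (· ∈ cells w) P ∧ vertexVec (A i) ∈ P := by
    intro i
    obtain ⟨u, hu⟩ := exists_mem_lowerFace w (A i)
    obtain ⟨P, hP, hmax⟩ := (cells_finite w).exists_le_maximal
      (⟨u, rfl⟩ : subsetPolytope (lowerFace w u) ∈ cells w)
    exact ⟨P, hmax, hP (subset_convexHull ℝ _ ⟨_, hu, rfl⟩)⟩
  choose P hP hmem using hmax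
  have hinj : Function.Injective P := by
    intro i j hij
    obtain ⟨u, hu⟩ := (hP i).prop
    refine hA i j u (mem_of_vertexVec_mem_subsetPolytope (hu ▸ hmem i))
      (mem_of_vertexVec_mem_subsetPolytope (hu ▸ hij ▸ hmem j))
  have hfin : {P | Maximal (· ∈ cells w) P}.Finite :=
    (cells_finite w).subset fun P hP => hP.prop
  rw [← Nat.card_eq_fintype_card, ← Set.ncard_univ, ← Set.ncard_image_of_injective _ hinj]
  refine Set.ncard_le_ncard ?_ hfin
  rintro _ ⟨i, -, rfl⟩
  exact hP i

/-! ### Invariance under scaling and the lineality space -/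

lemma lowerFace_smul_add {d n : ℕ} (w : Weight d n) (u v : Fin n → ℝ) {c : ℝ} (hc : 0 < c) :
    lowerFace (c • w + linealityMap d n v) (c • u + v) = lowerFace w u := by
  ext X
  have h : c • w + linealityMap d n v - linealityMap d n (c • u + v) =
      c • (w - linealityMap d n u) := by
    rw [map_add, map_smul, smul_sub]
    abel
  simp only [mem_lowerFace_iff, h, Pi.smul_apply, smul_eq_mul, mul_le_mul_iff_right₀ hc]

lemma cells_smul_add {d n : ℕ} (w : Weight d n) (v : Fin n → ℝ) {c : ℝ} (hc : 0 < c) :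
    cells (c • w + linealityMap d n v) = cells w := by
  ext P
  constructor
  · rintro ⟨u, rfl⟩
    refine ⟨c⁻¹ • (u - v), ?_⟩
    rw [← lowerFace_smul_add w (c⁻¹ • (u - v)) v hc, smul_inv_smul₀ hc.ne', sub_add_cancel]
  · rintro ⟨u, rfl⟩
    exact ⟨c • u + v, by rw [lowerFace_smul_add w u v hc]⟩

lemma inducesTrivialSubdivision_of_mem_lineality {d n : ℕ} {w : Weight d n}
    (h : w ∈ lineality d n) : InducesTrivialSubdivision w := by
  obtain ⟨u, rfl⟩ := h
  refine ⟨u, ?_⟩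
  have : lowerFace (linealityMap d n u) u = Set.univ := by
    ext X
    simp [mem_lowerFace_iff]
  rw [this, hypersimplex]

lemma mem_lineality_of_inducesTrivialSubdivision {n : ℕ} {w : Weight 3 n}
    (h : InducesTrivialSubdivision w) : w ∈ lineality 3 n := by
  obtain ⟨u, hu⟩ := h
  have huniv : ∀ X, X ∈ lowerFace w u := fun X =>
    subset_of_subsetPolytope_subset hu.subset (Set.mem_univ X)
  simp only [mem_lowerFace_iff] at huniv
  rcases isEmpty_or_nonempty (DSubset 3 n) with hE | ⟨⟨X₀⟩⟩
  · exact ⟨0, Subsingleton.elim _ _⟩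
  -- A constant weight vector is itself in the lineality space: in rank three, spread a third of the
  -- constant over each element.
  refine ⟨u + fun _ => (w - linealityMap 3 n u) X₀ / 3, ?_⟩
  ext X
  have hX : (w - linealityMap 3 n u) X = (w - linealityMap 3 n u) X₀ :=
    le_antisymm (huniv _ _) (huniv _ _)
  rw [map_add, Pi.add_apply, ← hX]
  simp [linealityMap, X.2]
  ring

/-! ### Coarsenings and initial terms -/

/-- The triples through s inside {s, i, j, k, l} span an octahedral face of the hypersimplex, and a
lowest term is a diagonal of it lying in a cell. A supporting functional on the octahedron is
extended to all triples by a large penalty. -/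
lemma exists_lowerFace_pair {n : ℕ} (w : Weight 3 n) {s i j k l : Fin n}
    (hn : [s, i, j, k, l].Nodup)
    (h₁ : coord w s i j + coord w s k l ≤ coord w s i k + coord w s j l)
    (h₂ : coord w s i j + coord w s k l ≤ coord w s i l + coord w s j k) :
    ∃ u, ∀ X : DSubset 3 n, X.1 = {s, i, j} ∨ X.1 = {s, k, l} → X ∈ lowerFace w u := by
  simp only [List.nodup_cons, List.mem_cons, List.not_mem_nil, not_or, or_false,
    List.nodup_nil, not_false_eq_true, and_true] at hn
  obtain ⟨⟨hsi, hsj, hsk, hsl⟩, ⟨hij, hik, hil⟩, ⟨hjk, hjl⟩, hkl⟩ := hn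
  set a := coord w s i j with ha
  set b := coord w s k l with hb
  set p := coord w s i k with hp
  set q := coord w s j l with hq
  set r := coord w s i l with hr
  set t := coord w s j k with ht
  -- Chosen so that v is exact at ij, kl, ik and il; at jl and jk it gives a + b - p and a + b - r,
  -- which are at most q and t by the two hypotheses.
  let v : Fin n → ℝ := fun x => if x = i then (p + r - b) / 2 else if x = j then
    a - (p + r - b) / 2 else if x = k then (p - r + b) / 2 else if x = l then
    b - (p - r + b) / 2 else 0
  have vs : v s = 0 := by simp [v, *]
  have vi : v i = (p + r - b) / 2 := by simp [v]
  have vj : v j = a - (p + r - b) / 2 := by simp [v, Ne.symm hij]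
  have vk : v k = (p - r + b) / 2 := by simp [v, Ne.symm hik, Ne.symm hjk]
  have vl : v l = b - (p - r + b) / 2 := by simp [v, Ne.symm hil, Ne.symm hjl, Ne.symm hkl]
  obtain ⟨K₀, hK₀⟩ := (Set.finite_range fun Y : DSubset 3 n => ∑ x ∈ Y.1, v x - w Y).bddAbove
  obtain ⟨K, hK, hK0⟩ : ∃ K : ℝ, (∀ Y : DSubset 3 n, ∑ x ∈ Y.1, v x - w Y ≤ K) ∧ 0 ≤ K :=
    ⟨max K₀ 0, fun Y => (hK₀ ⟨Y, rfl⟩).trans (le_max_left _ _), le_max_right _ _⟩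
  clear_value v
  -- The penalty sums to K on the triples of the octahedron and to at most 0 on all others.
  let f : Fin n → ℝ := fun x => if x = s then K else
    if x = i ∨ x = j ∨ x = k ∨ x = l then 0 else -K
  have fs : f s = K := by simp [f]
  have f0 : ∀ x, x ≠ s → (x = i ∨ x = j ∨ x = k ∨ x = l) → f x = 0 := fun x hx h => by
    simp only [f, if_neg hx, if_pos h]
  have fK : ∀ x, x ≠ s → ¬ (x = i ∨ x = j ∨ x = k ∨ x = l) → f x = -K := fun x hx h => by
    simp only [f, if_neg hx, if_neg h]
  have fle : ∀ x, x ≠ s → f x ≤ 0 := fun x hx => by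
    by_cases h : x = i ∨ x = j ∨ x = k ∨ x = l
    · exact (f0 x hx h).le
    · rw [fK x hx h]; linarith
  clear_value f
  have key : ∀ Y : DSubset 3 n, -K ≤ w Y - ∑ x ∈ Y.1, (f x + v x) := by
    intro Y
    rw [Finset.sum_add_distrib]
    suffices (∑ x ∈ Y.1, f x ≤ 0) ∨ -K ≤ w Y - (∑ x ∈ Y.1, f x + ∑ x ∈ Y.1, v x) by
      rcases this with h | h
      · linarith [hK Y]
      · exact h
    by_cases hsY : s ∈ Y.1
    · obtain ⟨x, y, hxy, hxy'⟩ := Finset.card_eq_two.1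
        (by rw [Finset.card_erase_of_mem hsY, Y.2] : (Y.1.erase s).card = 2)
      have hY : Y.1 = {s, x, y} := by rw [← Finset.insert_erase hsY, hxy']
      have hxs : x ≠ s := Finset.ne_of_mem_erase (by rw [hxy']; simp : x ∈ Y.1.erase s)
      have hys : y ≠ s := Finset.ne_of_mem_erase (by rw [hxy']; simp : y ∈ Y.1.erase s)
      rw [sum_triple f Y hY, sum_triple v Y hY, coord_of_eq w Y hY, fs, vs]
      by_cases hx : x = i ∨ x = j ∨ x = k ∨ x = l
      · by_cases hy : y = i ∨ y = j ∨ y = k ∨ y = l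
        · right
          rw [f0 x hxs hx, f0 y hys hy]
          rcases hx with rfl | rfl | rfl | rfl <;> rcases hy with rfl | rfl | rfl | rfl <;>
            first
            | exact absurd rfl hxy
            | (rw [vi, vj]; linarith)
            | (rw [vi, vk]; linarith)
            | (rw [vi, vl]; linarith)
            | (rw [vj, vk]; linarith)
            | (rw [vj, vl]; linarith)
            | (rw [vk, vl]; linarith)
            | (rw [coord_comm₂₃, vj, vi]; linarith)
            | (rw [coord_comm₂₃, vk, vi]; linarith)
            | (rw [coord_comm₂₃, vl, vi]; linarith)
            | (rw [coord_comm₂₃, vk, vj]; linarith)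
            | (rw [coord_comm₂₃, vl, vj]; linarith)
            | (rw [coord_comm₂₃, vl, vk]; linarith)
        · left
          linarith [fle x hxs, fK y hys hy]
      · left
        linarith [fle y hys, fK x hxs hx]
    · left
      exact Finset.sum_nonpos fun x hx => fle x fun h => hsY (h ▸ hx)
  refine ⟨fun x => f x + v x, fun X hX Y => ?_⟩
  rw [sum_mul_vertexVec, sum_mul_vertexVec]
  refine le_trans (le_of_eq ?_) (key Y)
  rcases hX with hX | hX
  · rw [sum_triple _ X hX, coord_of_eq w X hX, fs, vs, f0 i (Ne.symm hsi) (by simp),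
      f0 j (Ne.symm hsj) (by simp), vi, vj]
    linarith
  · rw [sum_triple _ X hX, coord_of_eq w X hX, fs, vs, f0 k (Ne.symm hsk) (by simp),
      f0 l (Ne.symm hsl) (by simp), vk, vl]
    linarith

lemma lowerFace_pair_le {n : ℕ} (w : Weight 3 n) (u : Fin n → ℝ) {s i j k l : Fin n}
    (hn : [s, i, j, k, l].Nodup)
    (hu : ∀ X : DSubset 3 n, X.1 = {s, i, j} ∨ X.1 = {s, k, l} → X ∈ lowerFace w u) :
    coord w s i j + coord w s k l ≤ coord w s i k + coord w s j l := by
  simp only [List.nodup_cons, List.mem_cons, List.not_mem_nil, not_or, or_false,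
    List.nodup_nil, not_false_eq_true, and_true] at hn
  obtain ⟨⟨hsi, hsj, hsk, hsl⟩, ⟨hij, hik, hil⟩, ⟨hjk, hjl⟩, hkl⟩ := hn
  obtain ⟨X, hX⟩ := exists_triple hsi hsj hij
  obtain ⟨X', hX'⟩ := exists_triple hsk hsl hkl
  obtain ⟨Y, hY⟩ := exists_triple hsi hsk hik
  obtain ⟨Y', hY'⟩ := exists_triple hsj hsl hjl
  have h₁ := hu X (Or.inl hX) Y
  have h₂ := hu X' (Or.inr hX') Y'
  simp only [sum_mul_vertexVec] at h₁ h₂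
  rw [sum_triple _ _ hX, sum_triple _ _ hY, coord_of_eq w _ hX, coord_of_eq w _ hY] at h₁
  rw [sum_triple _ _ hX', sum_triple _ _ hY', coord_of_eq w _ hX', coord_of_eq w _ hY'] at h₂
  linarith

lemma Coarsens.pair_le {n : ℕ} {w w' : Weight 3 n} (h : Coarsens w' w) {s i j k l : Fin n}
    (hn : [s, i, j, k, l].Nodup)
    (h₁ : coord w s i j + coord w s k l ≤ coord w s i k + coord w s j l)
    (h₂ : coord w s i j + coord w s k l ≤ coord w s i l + coord w s j k) :
    coord w' s i j + coord w' s k l ≤ coord w' s i k + coord w' s j l ∧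
      coord w' s i j + coord w' s k l ≤ coord w' s i l + coord w' s j k := by
  obtain ⟨u, hu⟩ := exists_lowerFace_pair w hn h₁ h₂
  obtain ⟨_, ⟨u', rfl⟩, hQ⟩ := h _ ⟨u, rfl⟩
  have hsub := subset_of_subsetPolytope_subset hQ
  refine ⟨lowerFace_pair_le w' u' hn fun X hX => hsub (hu X hX), ?_⟩
  rw [coord_comm₂₃ w' s k l]
  refine lowerFace_pair_le w' u' (by simp at hn ⊢; grind) fun X hX => hsub (hu X ?_)
  rwa [Finset.pair_comm l k] at hX

/-- A term is lowest exactly when its two triples share a cell, and sharing a cell survives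
coarsening. -/
lemma Coarsens.initialTerms_subset {n : ℕ} {w w' : Weight 3 n} (h : Coarsens w' w)
    (τ : ThreeTerm 3 n) : τ.initialTerms w ⊆ τ.initialTerms w' := by
  obtain ⟨s, i, j, k, l, hn, hτ⟩ := τ.exists_weights_eq
  intro m hm
  simp only [mem_initialTerms, hτ, plueckerTerms, Fin.forall_fin_succ] at hm ⊢
  have c := coord_comm₂₃ (n := n)
  fin_cases m
  · simp at hm ⊢
    exact h.pair_le hn hm.1 hm.2
  · simp at hm ⊢
    have := h.pair_le (s := s) (i := i) (j := k) (k := j) (l := l) (by simp at hn ⊢; grind)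
      (by linarith [hm.1]) (by rw [c w s k j]; linarith [hm.2])
    rwa [c w' s k j] at this
  · simp at hm ⊢
    have := h.pair_le (s := s) (i := i) (j := l) (k := j) (l := k) (by simp at hn ⊢; grind)
      (by rw [c w s l k]; linarith [hm.1]) (by rw [c w s l j]; linarith [hm.2])
    rwa [c w' s l k, c w' s l j] at this

lemma weights_add {n : ℕ} (τ : ThreeTerm 3 n) (v w : Weight 3 n) :
    τ.weights (v + w) = τ.weights v + τ.weights w := by
  ext m
  fin_cases m <;> simp [ThreeTerm.weights] <;> ring

lemma weights_smul {n : ℕ} (τ : ThreeTerm 3 n) (c : ℝ) (w : Weight 3 n) :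
    τ.weights (c • w) = c • τ.weights w := by
  ext m
  fin_cases m <;> simp [ThreeTerm.weights] <;> ring

lemma weights_linealityMap {n : ℕ} (τ : ThreeTerm 3 n) (u : Fin n → ℝ) (m m' : Fin 3) :
    τ.weights (linealityMap 3 n u) m = τ.weights (linealityMap 3 n u) m' := by
  obtain ⟨s, i, j, k, l, hn, hτ⟩ := τ.exists_weights_eq
  simp only [List.nodup_cons, List.mem_cons, List.not_mem_nil, not_or, or_false] at hn
  obtain ⟨⟨h1, h2, h3, h4⟩, ⟨h5, h6, h7⟩, ⟨h8, h9⟩, h10, -⟩ := hn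
  simp only [plueckerTerms, coord_linealityMap, ne_eq, not_false_eq_true, *]
  fin_cases m <;> fin_cases m' <;> simp <;> ring

/-- Weights that span rays of the Dressian induce coarsest matroid subdivisions. -/
theorem SpansRay.inducesCoarsestMatroidSubdivision {n : ℕ} (hn : 3 ≤ n) {w : Weight 3 n}
    (hw : SpansRay w) : InducesCoarsestMatroidSubdivision w := by
  obtain ⟨hD, hL, hcone⟩ := hw
  refine ⟨inducesMatroidSubdivision_of_mem_dressian hn hD,
    fun h => hL (mem_lineality_of_inducesTrivialSubdivision h), fun w' _ hnt hco => ?_⟩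
  have hmem : ∀ M : ℝ, 0 ≤ M → w + M • w' ∈ pluckerCone w := by
    intro M hM τ
    have hsub := hco.initialTerms_subset τ
    obtain ⟨m₀, hm₀, -⟩ := hD τ
    ext m
    simp only [mem_initialTerms, weights_add, weights_smul, Pi.add_apply, Pi.smul_apply,
      smul_eq_mul]
    have hm₀' := hsub hm₀
    rw [mem_initialTerms] at hm₀ hm₀'
    constructor
    · intro h m'
      have h1 := h m₀
      have h2 := mul_le_mul_of_nonneg_left (hm₀' m) hM
      linarith [hm₀ m']
    · intro h m'
      have h' := hsub h
      linarith [h m', mul_le_mul_of_nonneg_left (h' m') hM]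
  have hray : ∀ M : ℝ, 0 ≤ M → ∃ c : ℝ, 0 < c ∧ w + M • w' - c • w ∈ lineality 3 n := by
    intro M hM
    have := hmem M hM
    rwa [hcone] at this
  obtain ⟨c, hc, hcL⟩ := hray 1 zero_le_one
  have hc1 : 1 ≤ c := by
    by_contra! hlt
    have hc0 : 0 < 1 - c := sub_pos.2 hlt
    -- Since w' ≡ (c - 1)w modulo lineality, this value of M makes w + Mw' vanish there, which no
    -- positive multiple of w does.
    obtain ⟨c', hc', hL'⟩ := hray (1 / (1 - c)) (by positivity)
    refine hL ?_
    have h1 := (lineality 3 n).sub_mem ((lineality 3 n).smul_mem (1 / (1 - c)) hcL) hL'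
    have h2 : (1 / (1 - c)) • (w + (1 : ℝ) • w' - c • w) - (w + (1 / (1 - c)) • w' - c' • w) =
        c' • w := by
      have : (1 - c) ≠ 0 := by linarith
      ext X
      simp only [Pi.sub_apply, Pi.add_apply, Pi.smul_apply, smul_eq_mul]
      field_simp
      ring
    rw [h2] at h1
    simpa [smul_smul, hc'.ne'] using (lineality 3 n).smul_mem c'⁻¹ h1
  obtain ⟨u, hu⟩ := hcL
  have hw' : w' = (c - 1) • w + linealityMap 3 n u := by
    rw [hu, sub_smul]
    module
  rcases hc1.eq_or_lt with rfl | hlt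
  · exact absurd (inducesTrivialSubdivision_of_mem_lineality ⟨u, by simp [hw']⟩) hnt
  · rw [hw', cells_smul_add w u (by linarith)]

/-! ### A linear criterion for spanning a ray -/

/-- `v` is constant on the lowest terms with respect to `w` of every three term relation. -/
def IsBalanced {n : ℕ} (w v : Weight 3 n) : Prop :=
  ∀ (τ : ThreeTerm 3 n) (m m' : Fin 3), m ∈ τ.initialTerms w → m' ∈ τ.initialTerms w →
    τ.weights v m = τ.weights v m'

lemma isBalanced_self {n : ℕ} (w : Weight 3 n) : IsBalanced w w := fun _ _ _ hm hm' =>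
  le_antisymm (hm _) (hm' _)

lemma IsBalanced.sub_smul_add {n : ℕ} {w v : Weight 3 n} (hv : IsBalanced w v) (c : ℝ)
    (u : Fin n → ℝ) : IsBalanced w (v - (c • w + linealityMap 3 n u)) := by
  intro τ m m' hm hm'
  have h : v - (c • w + linealityMap 3 n u) =
      v + ((-1 : ℝ) • c • w + (-1 : ℝ) • linealityMap 3 n u) := by module
  simp only [h, weights_add, weights_smul, Pi.add_apply, Pi.smul_apply, hv τ m m' hm hm',
    isBalanced_self w τ m m' hm hm', weights_linealityMap τ u m m']

lemma initialTerms_smul_add {n : ℕ} (τ : ThreeTerm 3 n) (w : Weight 3 n) (u : Fin n → ℝ) {c : ℝ}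
    (hc : 0 < c) : τ.initialTerms (c • w + linealityMap 3 n u) = τ.initialTerms w := by
  ext m
  simp only [mem_initialTerms, weights_add, weights_smul, Pi.add_apply, Pi.smul_apply, smul_eq_mul]
  refine forall_congr' fun m' => ?_
  rw [weights_linealityMap τ u m m', add_le_add_iff_right, mul_le_mul_iff_right₀ hc]

theorem spansRay_of_isBalanced {n : ℕ} {w : Weight 3 n} (hD : w ∈ Dressian 3 n)
    (hne : ∃ (τ : ThreeTerm 3 n) (m m' : Fin 3), τ.weights w m ≠ τ.weights w m')
    (hV : ∀ v, IsBalanced w v → ∃ c : ℝ, v - c • w ∈ lineality 3 n) : SpansRay w := by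
  obtain ⟨τ, m, m', hm⟩ := hne
  refine ⟨hD, ?_, Set.Subset.antisymm (fun w' hw' => ?_) ?_⟩
  · rintro ⟨u, rfl⟩
    exact hm (weights_linealityMap τ u m m')
  · obtain ⟨c, u, hu⟩ := hV w' fun σ i j hi hj => by
      rw [← hw' σ] at hi hj
      exact le_antisymm (hi _) (hj _)
    have hw : w' = c • w + linealityMap 3 n u := by rw [hu]; abel
    refine ⟨c, ?_, u, hu⟩
    -- A nonpositive c reverses the order of the terms. As w and w' have the same lowest terms, all
    -- terms of each relation would then be equal, contrary to `hne`.
    by_contra! hc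
    obtain ⟨m₀, hm₀, -⟩ := hD τ
    have hm₀' := hm₀
    rw [← hw' τ] at hm₀'
    have hall : ∀ i, i ∈ τ.initialTerms w := by
      intro i
      rw [← hw' τ, hw]
      intro j
      have h1 := mul_le_mul_of_nonpos_left (hm₀ i) hc
      have h2 := hm₀' j
      have h3 := mul_le_mul_of_nonpos_left (hm₀ j) hc
      simp only [hw, weights_add, weights_smul, Pi.add_apply, Pi.smul_apply, smul_eq_mul,
        weights_linealityMap τ u _ 0] at h1 h2 h3 ⊢
      linarith
    exact hm (isBalanced_self w τ m m' (hall m) (hall m'))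
  · rintro w' ⟨c, hc, u, hu⟩ τ
    have hw : w' = c • w + linealityMap 3 n u := by rw [hu]; abel
    rw [hw, initialTerms_smul_add τ w u hc]

lemma IsBalanced.terms_eq {n : ℕ} {w v : Weight 3 n} (hv : IsBalanced w v) {s i j k l : Fin n}
    (hn : [s, i, j, k, l].Nodup)
    (h₁ : coord w s i j + coord w s k l = coord w s i k + coord w s j l)
    (h₂ : coord w s i j + coord w s k l ≤ coord w s i l + coord w s j k) :
    coord v s i j + coord v s k l = coord v s i k + coord v s j l := by
  obtain ⟨τ, hτ⟩ := exists_threeTerm hn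
  have := hv τ 0 1
  simp only [mem_initialTerms, hτ, plueckerTerms, Fin.forall_fin_succ] at this
  simp at this
  exact this h₁.le h₂ h₁.ge (by linarith)

/-! ### The weights of a strip of lattice points -/

/-- The common value of the strip weights at the triples whose smallest elements are `a < b`. -/
def stripPair (a b : ℕ) : ℕ := a / 2 + b / 2 + min (a % 2) (b % 2)

/-- The tropical minors of a configuration of lattice points on two adjacent diagonals. -/
noncomputable def stripWeight (n : ℕ) : Weight 3 n := fun X =>
  X.1.offDiag.inf' (Finset.card_pos.1 (by rw [Finset.offDiag_card, X.2]; norm_num))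
    fun p => (stripPair p.1 p.2 : ℝ)

lemma coord_stripWeight {n : ℕ} {a b c : Fin n} (hab : a < b) (hbc : b < c) :
    coord (stripWeight n) a b c = stripPair a b := by
  have hac := hab.trans hbc
  obtain ⟨X, hX⟩ := exists_triple hab.ne hac.ne hbc.ne
  rw [← coord_of_eq _ X hX, stripWeight]
  apply le_antisymm
  · exact Finset.inf'_le (fun p : Fin n × Fin n => (stripPair p.1 p.2 : ℝ))
      (b := (a, b)) (by simp [hX, hab.ne])
  · refine Finset.le_inf' _ _ ?_
    rintro ⟨x, y⟩ hxy
    simp only [hX, Finset.mem_offDiag, Finset.mem_insert, Finset.mem_singleton] at hxy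
    have h₁ : a.1 < b.1 := hab
    have h₂ : b.1 < c.1 := hbc
    norm_cast
    simp only [stripPair]
    rcases hxy with ⟨rfl | rfl | rfl, rfl | rfl | rfl, hne⟩ <;>
      first
      | exact absurd rfl hne
      | omega

lemma MinTwice.swap₁₂ {x y z : ℝ} (h : MinTwice x y z) : MinTwice y x z := by
  unfold MinTwice at *; grind

lemma MinTwice.swap₂₃ {x y z : ℝ} (h : MinTwice x y z) : MinTwice x z y := by
  unfold MinTwice at *; grind

/-- The three terms of a relation are only permuted by the symmetries of i, j, k, l, so the Dressian
condition need be checked on sorted indices alone. -/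
lemma forall_distinct_of_lt {α : Type*} [LinearOrder α] {P : α → α → α → α → Prop}
    (h₁₂ : ∀ i j k l, P i j k l → P j i k l) (h₂₃ : ∀ i j k l, P i j k l → P i k j l)
    (hpair : ∀ i j k l, P i j k l → P k l i j)
    (hP : ∀ i j k l, i < j → j < k → k < l → P i j k l) {i j k l : α}
    (hn : [i, j, k, l].Nodup) : P i j k l := by
  have h₃₄ : ∀ i j k l, P i j k l → P i j l k := fun i j k l h =>
    hpair _ _ _ _ (h₁₂ _ _ _ _ (hpair _ _ _ _ h))
  have key : ∀ i j k l, i < j → k < l → i < k → j ≠ k → j ≠ l → P i j k l := by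
    intro i j k l hij hkl hik hjk hjl
    rcases hjk.lt_or_gt with h | h
    · exact hP _ _ _ _ hij h hkl
    · rcases hjl.lt_or_gt with h' | h'
      · exact h₂₃ _ _ _ _ (hP _ _ _ _ hik h h')
      · exact h₂₃ _ _ _ _ (h₃₄ _ _ _ _ (hP _ _ _ _ hik hkl h'))
  have key' : ∀ i j k l, i < j → k < l → [i, j, k, l].Nodup → P i j k l := by
    intro i j k l hij hkl hn
    simp at hn
    rcases lt_or_gt_of_ne hn.1.2.1 with h | h
    · exact key _ _ _ _ hij hkl h hn.2.1.1 hn.2.1.2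
    · exact hpair _ _ _ _ (key _ _ _ _ hkl hij h (Ne.symm hn.1.2.2) (Ne.symm hn.2.1.2))
  have hn' := hn
  simp at hn'
  rcases lt_or_gt_of_ne hn'.1.1 with h | h <;> rcases lt_or_gt_of_ne hn'.2.2 with h' | h'
  · exact key' _ _ _ _ h h' hn
  · exact h₃₄ _ _ _ _ (key' _ _ _ _ h h' (by simp; grind))
  · exact h₁₂ _ _ _ _ (key' _ _ _ _ h h' (by simp; grind))
  · exact h₁₂ _ _ _ _ (h₃₄ _ _ _ _ (key' _ _ _ _ h h' (by simp; grind)))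

theorem stripWeight_mem_dressian (n : ℕ) : stripWeight n ∈ Dressian 3 n := by
  rw [mem_dressian_three]
  intro s i j k l hn
  have c := coord_comm₂₃ (stripWeight n)
  have d := coord_comm₁₂ (stripWeight n)
  rw [List.nodup_cons] at hn
  obtain ⟨hs, hn⟩ := hn
  revert hs
  refine forall_distinct_of_lt (P := fun i j k l => s ∉ [i, j, k, l] → MinTwice
    (coord (stripWeight n) s i j + coord (stripWeight n) s k l)
    (coord (stripWeight n) s i k + coord (stripWeight n) s j l)
    (coord (stripWeight n) s i l + coord (stripWeight n) s j k)) ?_ ?_ ?_ ?_ hn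
  · intro i j k l h hs
    have := (h (by simp at hs ⊢; grind)).swap₂₃
    rwa [c s i j, add_comm (coord _ s i l), add_comm (coord _ s i k)] at this
  · intro i j k l h hs
    have := (h (by simp at hs ⊢; grind)).swap₁₂
    rwa [c s j k] at this
  · intro i j k l h hs
    have := h (by simp at hs ⊢; grind)
    rwa [add_comm, c s i k, c s j l, c s i l, c s j k, add_comm (coord _ s l i)] at this
  · intro i j k l hij hjk hkl hs
    simp only [List.mem_cons, List.not_mem_nil, not_or, or_false] at hs
    have hij' : i.1 < j.1 := hij
    have hjk' : j.1 < k.1 := hjk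
    have hkl' : k.1 < l.1 := hkl
    have hik := hij.trans hjk
    have hjl := hjk.trans hkl
    have hil := hij.trans hjl
    rcases lt_or_gt_of_ne hs.1 with h | h
    · have h' : s.1 < i.1 := h
      rw [coord_stripWeight h hij, coord_stripWeight h hik, coord_stripWeight h hil,
        coord_stripWeight (h.trans hij) hjk, coord_stripWeight (h.trans hij) hjl,
        coord_stripWeight (h.trans hik) hkl]
      unfold MinTwice stripPair
      norm_cast
      omega
    have hi' : i.1 < s.1 := h
    rw [d s i j, d s i k, d s i l]
    rcases lt_or_gt_of_ne hs.2.1 with h | h₂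
    · have h' : s.1 < j.1 := h
      rw [coord_stripWeight ‹i < s› h, coord_stripWeight ‹i < s› (h.trans hjk),
        coord_stripWeight ‹i < s› (h.trans hjl), coord_stripWeight h hjk, coord_stripWeight h hjl,
        coord_stripWeight (h.trans hjk) hkl]
      unfold MinTwice stripPair
      norm_cast
      omega
    have hj' : j.1 < s.1 := h₂
    rw [c i s j, d s j k, d s j l]
    rcases lt_or_gt_of_ne hs.2.2.1 with h | h₃
    · have h' : s.1 < k.1 := h
      rw [coord_stripWeight hij h₂, coord_stripWeight ‹i < s› h, coord_stripWeight ‹i < s›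
        (h.trans hkl), coord_stripWeight h₂ h, coord_stripWeight h₂ (h.trans hkl),
        coord_stripWeight h hkl]
      unfold MinTwice stripPair
      norm_cast
      omega
    have hk' : k.1 < s.1 := h₃
    rw [c i s k, c j s k, d s k l]
    rcases lt_or_gt_of_ne hs.2.2.2 with h | h₄
    · have h' : s.1 < l.1 := h
      rw [coord_stripWeight hij h₂, coord_stripWeight hik h₃, coord_stripWeight ‹i < s› h,
        coord_stripWeight hjk h₃, coord_stripWeight h₂ h, coord_stripWeight h₃ h]
      unfold MinTwice stripPair
      norm_cast
      omega
    · have h' : l.1 < s.1 := h₄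
      rw [c i s l, c j s l, c k s l, coord_stripWeight hij h₂, coord_stripWeight hik h₃,
        coord_stripWeight hil h₄, coord_stripWeight hjk h₃, coord_stripWeight hjl h₄,
        coord_stripWeight hkl h₄]
      unfold MinTwice stripPair
      norm_cast
      omega

/-! ### Rigidity of the strip weights -/

lemma exists_sorted_triple {n : ℕ} (X : DSubset 3 n) :
    ∃ a b c : Fin n, a < b ∧ b < c ∧ X.1 = {a, b, c} := by
  refine ⟨X.1.orderEmbOfFin X.2 0, X.1.orderEmbOfFin X.2 1, X.1.orderEmbOfFin X.2 2, ?_, ?_, ?_⟩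
  · simp
  · simp
  · ext x
    have h := Set.ext_iff.1 (Finset.range_orderEmbOfFin X.1 X.2) x
    rw [Set.mem_range, Finset.mem_coe] at h
    rw [← h]
    simp [Fin.exists_fin_succ, eq_comm]

section Rigidity

variable {n : ℕ} {v : Weight 3 n} {A B C : Fin n}

/-- The weight ignores the largest element of a triple, so exchanging k and C between two triples
keeps the term lowest. -/
lemma IsBalanced.strip_first (hv : IsBalanced (stripWeight n) v) (hA : A.1 = 0) (hB : B.1 = 1)
    (hAB : ∀ j, B < j → coord v A B j = 0) {j k : Fin n} (hj : B < j) (hjk : j < k) (hk : k < C) :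
    coord v A j k = coord v A j C := by
  have hAB' : A < B := by rw [Fin.lt_def]; omega
  have c := coord_comm₂₃ (n := n)
  have hj' : B.1 < j.1 := hj
  have hjk' : j.1 < k.1 := hjk
  have h := hv.terms_eq (s := A) (i := B) (j := k) (k := C) (l := j) (by simp; grind)
    (by rw [c _ A C j, c _ A k j, coord_stripWeight hAB' (hj.trans hjk),
          coord_stripWeight (hAB'.trans hj) (hjk.trans hk), coord_stripWeight hAB'
          ((hj.trans hjk).trans hk), coord_stripWeight (hAB'.trans hj) hjk])
    (by rw [c _ A C j, coord_stripWeight hAB' (hj.trans hjk),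
          coord_stripWeight (hAB'.trans hj) (hjk.trans hk), coord_stripWeight hAB' hj,
          coord_stripWeight (hAB'.trans (hj.trans hjk)) hk]
        unfold stripPair; norm_cast; omega)
  rw [hAB k (hj.trans hjk), hAB C ((hj.trans hjk).trans hk), c v A C j, c v A k j] at h
  linarith

/-- The tropical minor of 0 and j is ⌊j/2⌋, so j and k are interchangeable next to A when they agree
in that coordinate. -/
lemma IsBalanced.strip_first_eq (hv : IsBalanced (stripWeight n) v) (hA : A.1 = 0) (hB : B.1 = 1)
    (hAB : ∀ j, B < j → coord v A B j = 0) {j k : Fin n} (hj : B < j) (hjk : j < k) (hk : k < C)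
    (he : j.1 / 2 = k.1 / 2) : coord v A k C = coord v A j C := by
  have hAB' : A < B := by rw [Fin.lt_def]; omega
  have hj' : B.1 < j.1 := hj
  have hjk' : j.1 < k.1 := hjk
  have h := hv.terms_eq (s := A) (i := B) (j := j) (k := k) (l := C) (by simp; grind)
    (by rw [coord_stripWeight hAB' hj, coord_stripWeight (hAB'.trans (hj.trans hjk)) hk,
          coord_stripWeight hAB' (hj.trans hjk), coord_stripWeight (hAB'.trans hj) (hjk.trans hk)]
        unfold stripPair; norm_cast; omega)
    (by rw [coord_stripWeight hAB' hj, coord_stripWeight (hAB'.trans (hj.trans hjk)) hk,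
          coord_stripWeight hAB' ((hj.trans hjk).trans hk), coord_stripWeight (hAB'.trans hj) hjk]
        unfold stripPair; norm_cast; omega)
  rw [hAB k (hj.trans hjk), hAB j hj] at h
  linarith

lemma IsBalanced.strip_second (hv : IsBalanced (stripWeight n) v) (hA : A.1 = 0) (hB : B.1 = 1)
    (hAB : ∀ j, B < j → coord v A B j = 0) {j k : Fin n} (hj : B < j) (hjk : j < k) (hk : k < C) :
    coord v B j k = coord v B j C := by
  have hAB' : A < B := by rw [Fin.lt_def]; omega
  have c := coord_comm₂₃ (n := n)
  have d := coord_comm₁₂ (n := n)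
  have hj' : B.1 < j.1 := hj
  have hjk' : j.1 < k.1 := hjk
  have h := hv.terms_eq (s := B) (i := A) (j := k) (k := C) (l := j) (by simp; grind)
    (by rw [d _ B A k, d _ B A C, c _ B C j, c _ B k j, coord_stripWeight hAB' (hj.trans hjk),
          coord_stripWeight hj (hjk.trans hk), coord_stripWeight hAB'
          ((hj.trans hjk).trans hk), coord_stripWeight hj hjk])
    (by rw [d _ B A k, d _ B A j, c _ B C j, coord_stripWeight hAB' (hj.trans hjk),
          coord_stripWeight hj (hjk.trans hk), coord_stripWeight hAB' hj,
          coord_stripWeight (hj.trans hjk) hk]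
        unfold stripPair; norm_cast; omega)
  rw [d v B A k, d v B A C, hAB k (hj.trans hjk), hAB C ((hj.trans hjk).trans hk), c v B C j,
    c v B k j] at h
  linarith

/-- The tropical minor of 1 and j is ⌈j/2⌉, the other coordinate of the staircase point. -/
lemma IsBalanced.strip_second_eq (hv : IsBalanced (stripWeight n) v) (hA : A.1 = 0)
    (hB : B.1 = 1) (hAB : ∀ j, B < j → coord v A B j = 0) {j k : Fin n} (hj : B < j) (hjk : j < k)
    (hk : k < C) (he : (j.1 + 1) / 2 = (k.1 + 1) / 2) : coord v B k C = coord v B j C := by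
  have hAB' : A < B := by rw [Fin.lt_def]; omega
  have d := coord_comm₁₂ (n := n)
  have hj' : B.1 < j.1 := hj
  have hjk' : j.1 < k.1 := hjk
  have h := hv.terms_eq (s := B) (i := A) (j := j) (k := k) (l := C) (by simp; grind)
    (by rw [d _ B A j, d _ B A k, coord_stripWeight hAB' hj, coord_stripWeight (hj.trans hjk) hk,
          coord_stripWeight hAB' (hj.trans hjk), coord_stripWeight hj (hjk.trans hk)]
        unfold stripPair; norm_cast; omega)
    (by rw [d _ B A j, d _ B A C, coord_stripWeight hAB' hj, coord_stripWeight (hj.trans hjk) hk,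
          coord_stripWeight hAB' ((hj.trans hjk).trans hk), coord_stripWeight hj hjk]
        unfold stripPair; norm_cast; omega)
  rw [d v B A j, d v B A k, hAB k (hj.trans hjk), hAB j hj] at h
  linarith

/-- Points of equal parity lie on the same diagonal, where ⌊j/2⌋ + ⌈k/2⌉ = ⌊k/2⌋ + ⌈j/2⌉ and this is
the tropical minor of j and k. -/
lemma IsBalanced.strip_last_eq (hv : IsBalanced (stripWeight n) v) (hA : A.1 = 0) (hB : B.1 = 1)
    {j k : Fin n} (hj : B < j) (hjk : j < k) (hk : k < C) (he : j.1 % 2 = k.1 % 2) :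
    coord v A j C + coord v B k C = coord v A k C + coord v B j C := by
  have hAB' : A < B := by rw [Fin.lt_def]; omega
  have e : ∀ w x y, coord w C x y = coord (n := n) w x y C := fun w x y => by
    rw [coord_comm₁₂, coord_comm₂₃]
  have hj' : B.1 < j.1 := hj
  have hjk' : j.1 < k.1 := hjk
  have h := hv.terms_eq (s := C) (i := A) (j := j) (k := k) (l := B) (by simp; grind)
    (by rw [e, e, e, e, coord_comm₁₂ _ k B, coord_comm₁₂ _ j B,
          coord_stripWeight (hAB'.trans hj) (hjk.trans hk), coord_stripWeight (hj.trans hjk) hk,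
          coord_stripWeight (hAB'.trans (hj.trans hjk)) hk, coord_stripWeight hj (hjk.trans hk)]
        unfold stripPair; norm_cast; omega)
    (by rw [e, e, e, e, coord_comm₁₂ _ k B,
          coord_stripWeight (hAB'.trans hj) (hjk.trans hk), coord_stripWeight (hj.trans hjk) hk,
          coord_stripWeight hAB' (hj.trans (hjk.trans hk)), coord_stripWeight hjk hk]
        unfold stripPair; norm_cast; omega)
  rwa [e, e, e, e, coord_comm₁₂ _ k B, coord_comm₁₂ _ j B] at h

lemma IsBalanced.strip_last (hv : IsBalanced (stripWeight n) v) (hA : A.1 = 0) (hB : B.1 = 1)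
    (hABC : coord v A B C = 0)
    (h₀ : ∀ j, B < j → j < C → coord v A j C = 0 ∧ coord v B j C = 0)
    {j k : Fin n} (hj : B < j) (hjk : j < k) (hk : k < C) : coord v j k C = 0 := by
  have hAB' : A < B := by rw [Fin.lt_def]; omega
  have e : ∀ w x y, coord w C x y = coord (n := n) w x y C := fun w x y => by
    rw [coord_comm₁₂, coord_comm₂₃]
  have hj' : B.1 < j.1 := hj
  have hjk' : j.1 < k.1 := hjk
  have s₁ := coord_stripWeight hAB' (hj.trans (hjk.trans hk))
  have s₂ := coord_stripWeight hjk hk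
  have s₃ := coord_stripWeight (hAB'.trans hj) (hjk.trans hk)
  have s₄ := coord_stripWeight (hj.trans hjk) hk
  have s₅ := coord_stripWeight (hAB'.trans (hj.trans hjk)) hk
  have s₆ := coord_stripWeight hj (hjk.trans hk)
  -- The parities decide which of ⌊k/2⌋ + ⌈j/2⌉ and ⌊j/2⌋ + ⌈k/2⌉ attains the tropical minor of j
  -- and k; the lowest pair used in the relation at C changes accordingly.
  rcases le_total (j.1 % 2) (k.1 % 2) with hp | hp
  · have h := hv.terms_eq (s := C) (i := A) (j := B) (k := k) (l := j) (by simp; grind)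
      (by rw [e, e, e, e, coord_comm₁₂ _ k j, s₁, s₂, s₅, s₆]
          unfold stripPair; norm_cast; omega)
      (by rw [e, e, e, e, coord_comm₁₂ _ k j, s₁, s₂, s₃, s₄]
          unfold stripPair; norm_cast; omega)
    rw [e, e, e, e, coord_comm₁₂ _ k j, hABC, (h₀ k (hj.trans hjk) hk).1,
      (h₀ j hj (hjk.trans hk)).2] at h
    linarith
  · have h := hv.terms_eq (s := C) (i := A) (j := B) (k := j) (l := k) (by simp; grind)
      (by rw [e, e, e, e, s₁, s₂, s₃, s₄]
          unfold stripPair; norm_cast; omega)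
      (by rw [e, e, e, e, s₁, s₂, s₅, s₆]
          unfold stripPair; norm_cast; omega)
    rw [e, e, e, e, hABC, (h₀ k (hj.trans hjk) hk).2, (h₀ j hj (hjk.trans hk)).1] at h
    linarith

lemma IsBalanced.strip_inner (hv : IsBalanced (stripWeight n) v) (hA : A.1 = 0)
    {j k l : Fin n} (hj : A < j) (hjk : j < k) (hkl : k < l) (hl : l < C) :
    coord v A j l + coord v j k C = coord v A j C + coord v j k l := by
  have d := coord_comm₁₂ (n := n)
  have c := coord_comm₂₃ (n := n)
  have hj' : A.1 < j.1 := hj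
  have hjk' : j.1 < k.1 := hjk
  have hkl' : k.1 < l.1 := hkl
  have h := hv.terms_eq (s := j) (i := A) (j := l) (k := C) (l := k) (by simp; grind)
    (by rw [d _ j A l, c _ j C k, d _ j A C, c _ j l k, coord_stripWeight hj (hjk.trans hkl),
          coord_stripWeight hjk (hkl.trans hl), coord_stripWeight hj (hjk.trans (hkl.trans hl)),
          coord_stripWeight hjk hkl])
    (by rw [d _ j A l, c _ j C k, d _ j A k, coord_stripWeight hj (hjk.trans hkl),
          coord_stripWeight hjk (hkl.trans hl), coord_stripWeight hj hjk,
          coord_stripWeight (hjk.trans hkl) hl]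
        unfold stripPair; norm_cast; omega)
  rwa [d _ j A l, c _ j C k, d _ j A C, c _ j l k] at h

lemma IsBalanced.strip_eq_zero (hv : IsBalanced (stripWeight n) v) (hA : A.1 = 0) (hB : B.1 = 1)
    (hC : C.1 + 1 = n) {P Q : Fin n} (hP : P.1 = 2) (hQ : Q.1 = 3) (hQC : Q < C)
    (hAB : ∀ j, B < j → coord v A B j = 0) (hAP : coord v A P C = 0) (hBP : coord v B P C = 0)
    (hBQ : coord v B Q C = 0) : v = 0 := by
  have hAB' : A < B := by rw [Fin.lt_def]; omega
  have hBP' : B < P := by rw [Fin.lt_def]; omega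
  have hPQ : P < Q := by rw [Fin.lt_def]; omega
  have hBC : B < C := hBP'.trans (hPQ.trans hQC)
  have h₀ : ∀ m : ℕ, ∀ j : Fin n, j.1 = m → B < j → j < C →
      coord v A j C = 0 ∧ coord v B j C = 0 := by
    intro m
    induction m using Nat.strong_induction_on with
    | _ m ih =>
      rintro j rfl hj hjC
      have hj' : B.1 < j.1 := hj
      rcases eq_or_ne j P with rfl | hjP
      · exact ⟨hAP, hBP⟩
      have hjP' : j.1 ≠ 2 := fun h => hjP (Fin.ext (h.trans hP.symm))
      let i : Fin n := ⟨j.1 - 1, by omega⟩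
      have hi : i.1 = j.1 - 1 := rfl
      have hij : i < j := by rw [Fin.lt_def]; omega
      have hBi : B < i := by rw [Fin.lt_def]; omega
      obtain ⟨h₁, h₂⟩ := ih i.1 (by omega) i rfl hBi (hij.trans hjC)
      -- Each step from j - 1 to j preserves one coordinate of the staircase point, so the matching
      -- value carries over. The other value follows because the difference of the two depends only
      -- on the parity of j; P and Q fix it for the even and the odd diagonal.
      rcases Nat.mod_two_eq_zero_or_one j.1 with hpar | hpar
      · have hx : coord v B j C = 0 := by
          rw [hv.strip_second_eq hA hB hAB hBi hij hjC (by omega), h₂]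
        have hPj : P < j := by rw [Fin.lt_def]; omega
        have := hv.strip_last_eq hA hB hBP' hPj hjC (by omega)
        exact ⟨by linarith, hx⟩
      · have hy : coord v A j C = 0 := by
          rw [hv.strip_first_eq hA hB hAB hBi hij hjC (by omega), h₁]
        rcases eq_or_ne j Q with rfl | hjQ
        · exact ⟨hy, hBQ⟩
        have hjQ' : j.1 ≠ 3 := fun h => hjQ (Fin.ext (h.trans hQ.symm))
        have hQj : Q < j := by rw [Fin.lt_def]; omega
        have := hv.strip_last_eq hA hB (hBP'.trans hPQ) hQj hjC (by omega)
        obtain ⟨h₃, -⟩ := ih Q.1 hQj Q rfl (hBP'.trans hPQ) hQC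
        exact ⟨hy, by linarith⟩
  replace h₀ : ∀ j, B < j → j < C → coord v A j C = 0 ∧ coord v B j C = 0 :=
    fun j => h₀ j.1 j rfl
  have leC : ∀ j : Fin n, j ≠ C → j < C := fun j hj => by
    have : j.1 ≠ C.1 := fun h => hj (Fin.ext h)
    rw [Fin.lt_def]; omega
  have hfirst : ∀ j k, B < j → j < k → coord v A j k = 0 := by
    intro j k hj hjk
    rcases eq_or_ne k C with rfl | hk
    · exact (h₀ j hj hjk).1
    · rw [hv.strip_first hA hB hAB hj hjk (leC k hk), (h₀ j hj (hjk.trans (leC k hk))).1]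
  ext X
  obtain ⟨a, b, c, hab, hbc, hX⟩ := exists_sorted_triple X
  rw [coord_of_eq v X hX, Pi.zero_apply]
  have hab' : a.1 < b.1 := hab
  rcases eq_or_ne a A with rfl | ha
  · rcases eq_or_ne b B with rfl | hb
    · exact hAB c hbc
    · have : b.1 ≠ B.1 := fun h => hb (Fin.ext h)
      exact hfirst b c (by rw [Fin.lt_def]; omega) hbc
  have ha' : a.1 ≠ A.1 := fun h => ha (Fin.ext h)
  have hbB : B < b := by rw [Fin.lt_def]; omega
  rcases eq_or_ne a B with rfl | hb
  · rcases eq_or_ne c C with rfl | hc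
    · exact (h₀ b hbB hbc).2
    · rw [hv.strip_second hA hB hAB hbB hbc (leC c hc), (h₀ b hbB (hbc.trans (leC c hc))).2]
  have hb' : a.1 ≠ B.1 := fun h => hb (Fin.ext h)
  have haB : B < a := by rw [Fin.lt_def]; omega
  rcases eq_or_ne c C with rfl | hc
  · exact hv.strip_last hA hB (hAB _ hBC) h₀ haB hab hbc
  · have h := hv.strip_inner hA (hAB'.trans haB) hab hbc (leC c hc)
    rw [hfirst a c haB (hab.trans hbc), hfirst a C haB (hab.trans (hbc.trans (leC c hc))),
      hv.strip_last hA hB (hAB _ hBC) h₀ haB hab (hbc.trans (leC c hc))] at h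
    linarith

end Rigidity

/-- The strip weights span rays of the Dressian. -/
theorem spansRay_stripWeight {n : ℕ} (hn : 5 ≤ n) : SpansRay (stripWeight n) := by
  let A : Fin n := ⟨0, by omega⟩
  let B : Fin n := ⟨1, by omega⟩
  let P : Fin n := ⟨2, by omega⟩
  let Q : Fin n := ⟨3, by omega⟩
  let C : Fin n := ⟨n - 1, by omega⟩
  have hAB : A < B := by simp [A, B]
  have hBP : B < P := by simp [B, P]
  have hPQ : P < Q := by simp [P, Q]
  have hQC : Q < C := by simp only [Q, C, Fin.lt_def]; omega
  have hBC := hBP.trans (hPQ.trans hQC)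
  refine spansRay_of_isBalanced (stripWeight_mem_dressian n) ?_ fun v hv => ?_
  · obtain ⟨τ, hτ⟩ := exists_threeTerm (s := B) (i := A) (j := P) (k := Q) (l := C)
      (by simp; grind)
    refine ⟨τ, 0, 1, ?_⟩
    simp only [hτ, plueckerTerms]
    simp only [Matrix.cons_val_zero, Matrix.cons_val_one, coord_comm₁₂ _ B A,
      coord_stripWeight hAB hBP, coord_stripWeight hAB (hBP.trans hPQ),
      coord_stripWeight hBP (hPQ.trans hQC), coord_stripWeight (hBP.trans hPQ) hQC]
    simp [stripPair, A, B, P, Q]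
  -- This combination of coordinates vanishes on the lineality space and equals 1 on the strip
  -- weights, so it reads off the multiple of w.
  · let c : ℝ := coord v B Q C - coord v A B Q - (coord v B P C - coord v A B P)
    let v₁ := v - c • stripWeight n
    let p := coord v₁ A B C + coord v₁ A B P - coord v₁ A P C
    let q := coord v₁ A B C + coord v₁ A B P - coord v₁ B P C
    -- With u j determined by the triples {A, B, j}, the triples {A, P, C} and {B, P, C} require uA
    -- + 2uB = p and 2uA + uB = q. The choice of c then makes {B, Q, C} vanish as well.
    let uA := (2 * q - p) / 3
    let uB := (2 * p - q) / 3
    let u : Fin n → ℝ := fun j => if j = A then uA else if j = B then uB else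
      coord v₁ A B j - uA - uB
    have huA : u A = uA := by simp [u]
    have huB : u B = uB := by simp [u, hAB.ne']
    have hu : ∀ j, B < j → u j = coord v₁ A B j - uA - uB := fun j hj => by
      simp [u, hj.ne', (hAB.trans hj).ne']
    have hv₁ : coord v₁ B Q C - coord v₁ A B Q = coord v₁ B P C - coord v₁ A B P := by
      simp only [v₁, coord_sub, coord_smul, coord_stripWeight hAB hBP,
        coord_stripWeight hAB (hBP.trans hPQ), coord_stripWeight hBP (hPQ.trans hQC),
        coord_stripWeight (hBP.trans hPQ) hQC]
      simp [stripPair, A, B, P, Q, c]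
      ring
    have hc : ∀ x y z, coord (v - (c • stripWeight n + linealityMap 3 n u)) x y z =
        coord v₁ x y z - coord (linealityMap 3 n u) x y z := fun x y z => by
      rw [← coord_sub, sub_add_eq_sub_sub]
    have h0 := (hv.sub_smul_add c u).strip_eq_zero (A := A) (B := B) (C := C) (P := P) (Q := Q)
      rfl rfl (Nat.sub_add_cancel (by omega)) rfl rfl hQC
      (fun j hj => by
        rw [hc, coord_linealityMap u hAB.ne (hAB.trans hj).ne hj.ne, huA, huB, hu j hj]; ring)
      (by
        rw [hc, coord_linealityMap u (hAB.trans hBP).ne (hAB.trans hBC).ne (hPQ.trans hQC).ne, huA,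
          hu P hBP, hu C hBC]
        simp only [uA, uB, p, q]; ring)
      (by
        rw [hc, coord_linealityMap u hBP.ne hBC.ne (hPQ.trans hQC).ne, huB, hu P hBP, hu C hBC]
        simp only [uA, uB, p, q]; ring)
      (by
        rw [hc, coord_linealityMap u (hBP.trans hPQ).ne hBC.ne hQC.ne, huB, hu Q (hBP.trans hPQ),
          hu C hBC]
        simp only [uA, uB, p, q]
        linarith)
    refine ⟨c, u, ?_⟩
    rw [← sub_eq_zero, ← neg_sub, neg_eq_zero, ← h0]
    abel

/-! ### The spread of the strip weights -/

lemma not_mem_lowerFace_of_lt {n : ℕ} (w : Weight 3 n) (u : Fin n → ℝ) {X X' Y Y' : DSubset 3 n}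
    (hsum : ∑ i ∈ X.1, u i + ∑ i ∈ X'.1, u i = ∑ i ∈ Y.1, u i + ∑ i ∈ Y'.1, u i)
    (hlt : w Y + w Y' < w X + w X') (hX : X ∈ lowerFace w u) : X' ∉ lowerFace w u := by
  intro hX'
  have h₁ := hX Y
  have h₂ := hX' Y'
  simp only [sum_mul_vertexVec] at h₁ h₂
  linarith

/-- For i < j, the triples {0, 2i+2, 2i+3} and {0, 2j+2, 2j+3} have weights i + 1 and j + 1.
Regrouping their elements by parity gives two triples of weight i + 1 each, a strictly smaller sum,
so the original two cannot lie on one lower face. -/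
theorem le_spread_stripWeight (m : ℕ) : m ≤ spread (stripWeight (2 * m + 3)) := by
  have hA : ∀ i : Fin m, ∃ X : DSubset 3 (2 * m + 3), X.1 =
      {⟨0, by omega⟩, ⟨2 * i.1 + 2, by omega⟩, ⟨2 * i.1 + 3, by omega⟩} := fun i =>
    exists_triple (a := ⟨0, by omega⟩) (b := ⟨2 * i.1 + 2, by omega⟩)
      (c := ⟨2 * i.1 + 3, by omega⟩) (by simp) (by simp) (by simp)
  choose A hA using hA
  have key : ∀ i j : Fin m, i < j → ∀ u, A i ∈ lowerFace (stripWeight _) u →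
      A j ∉ lowerFace (stripWeight _) u := by
    intro i j hij u
    have hij' : i.1 < j.1 := hij
    obtain ⟨Y, hY⟩ := exists_triple (n := 2 * m + 3) (a := ⟨0, by omega⟩)
      (b := ⟨2 * i.1 + 2, by omega⟩) (c := ⟨2 * j.1 + 2, by omega⟩) (by simp) (by simp)
      (by simp; omega)
    obtain ⟨Y', hY'⟩ := exists_triple (n := 2 * m + 3) (a := ⟨0, by omega⟩)
      (b := ⟨2 * i.1 + 3, by omega⟩) (c := ⟨2 * j.1 + 3, by omega⟩) (by simp) (by simp)
      (by simp; omega)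
    refine not_mem_lowerFace_of_lt _ u (Y := Y) (Y' := Y') ?_ ?_
    · rw [sum_triple u _ (hA i), sum_triple u _ (hA j), sum_triple u _ hY, sum_triple u _ hY']
      ring
    · rw [coord_of_eq (stripWeight _) _ (hA i), coord_of_eq (stripWeight _) _ (hA j),
        coord_of_eq (stripWeight _) _ hY, coord_of_eq (stripWeight _) _ hY']
      repeat rw [coord_stripWeight (by rw [Fin.lt_def]; dsimp only; omega)
        (by rw [Fin.lt_def]; dsimp only; omega)]
      unfold stripPair
      norm_cast
      simp only
      omega
  have := card_le_spread (stripWeight (2 * m + 3)) A fun i j u hi hj => by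
    rcases lt_trichotomy i j with h | h | h
    · exact absurd hj (key i j h u hi)
    · exact h
    · exact absurd hi (key j i h u hj)
  simpa using this

theorem proposition3p7 :
    ∀ C : ℕ, ∃ (n : ℕ) (w : Weight 3 n),
      SpansRay w ∧ InducesCoarsestMatroidSubdivision w ∧ C < spread w := by
  intro C
  have hray := spansRay_stripWeight (n := 2 * (C + 1) + 3) (by omega)
  exact ⟨_, _, hray, hray.inducesCoarsestMatroidSubdivision (by omega), le_spread_stripWeight _⟩
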